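/- Let $N>2$ robots $\mathcal V$ have pairwise distinct positions $p_i\in\mathbb R^2$ that do not all lie on one line. Let $\mathcal G_\Delta$ be the communication graph in which two robots are neighbours when their closed Voronoi cells $\{x : \|x-p_i\|\le\|x-p_j\|\ \forall j\}$ are adjacent (have a common point), or the edge graph of any Delaunay triangulation of the positions, i.e. of any triangulation of their convex hull whose vertices are exactly the positions and in which no position lies strictly inside the circumcircle of a triangle. (If no four positions lie on one circle, these graphs coincide.) Then: 1. $\mathcal G_\Delta$ is $(2,2)$-robust: for every pair of non-empty disjoint sets $S_1,S_2\subset\mathcal V$, with $\mathcal X_{S}=\{i\in S : |\mathcal N_i\setminus S|\ge 2\}$ ($\mathcal N_i$ the set of neighbours of $i$), at least one of $|\mathcal X_{S_1}|=|S_1|$, $|\mathcal X_{S_2}|=|S_2|$, $|\mathcal X_{S_1}|+|\mathcal X_{S_2}|\ge 2$ holds. 2. Hence W-MSR with $F=1$ on $\mathcal G_\Delta$ rejects one non-cooperative robot under the $F$-global threat model: suppose that at most one robot is non-cooperative (it shares an arbitrary real value $c^{(i)}[k]$ with all its neighbours at each step $k$), and that every cooperative robot $i$ updates by $$c^{(i)}[k+1]=w_{ii}[k]\,c^{(i)}[k]+\sum_{j\in\mathcal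 N_{i,-1}[k]}w_{ij}[k]\,c^{(j)}[k],$$ where $\mathcal N_{i,-1}[k]$ arises from $\mathcal N_i$ by removing a neighbour with the largest value among those whose value exceeds $c^{(i)}[k]$ and a neighbour with the smallest value among those whose value is below $c^{(i)}[k]$ (if there are such neighbours; ties are broken arbitrarily), and where for each such $i$ and $k$ the weights $w_{ii}[k]$ and $w_{ij}[k]$, $j\in\mathcal N_{i,-1}[k]$, sum to $1$ and are at least some constant $\alpha>0$ independent of $i,j,k$. Then the values of all cooperative robots converge to a common limit, which lies between the minimum and the maximum of the initial values of the cooperative robots. -/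

import Mathlib

open Filter Topology

section Robustness

variable {V : Type*} [Fintype V]

open Classical in
/-- The set `𝒩ᵢ` of neighbours of `i` in the communication graph `G`. -/
noncomputable def nbrs (G : SimpleGraph V) (i : V) : Finset V :=
  Finset.univ.filter fun j => G.Adj i j

open Classical in
/-- `𝒳_S^r`: the vertices of `S` that have at least `r` neighbours outside `S`. -/
noncomputable def reachable (G : SimpleGraph V) (r : ℕ) (S : Finset V) : Finset V :=
  S.filter fun i => r ≤ (nbrs G i \ S).card

/-- `(r, s)`-robustness of a communication graph. -/
def IsRSRobust (G : SimpleGraph V) (r s : ℕ) : Prop :=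
  ∀ S₁ S₂ : Finset V, S₁.Nonempty → S₂.Nonempty → Disjoint S₁ S₂ →
    (reachable G r S₁).card = S₁.card ∨
    (reachable G r S₂).card = S₂.card ∨
    s ≤ (reachable G r S₁).card + (reachable G r S₂).card

end Robustness

section WMSR

variable {V : Type*} [Fintype V]

/-- `U` consists of (the indices in `B` of) the `F` largest values of `x` on `B`; it is all of `B` if `B`
has at most `F` elements. Ties may be broken in any way. -/
def IsLargestPart (F : ℕ) (x : V → ℝ) (B U : Finset V) : Prop :=
  U ⊆ B ∧ U.card = min F B.card ∧ ∀ u ∈ U, ∀ j ∈ B, j ∉ U → x j ≤ x u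

open Classical in
/-- `R` is a possible value of `𝒩_{i,-F}` when the robots share the values `x`: from the neighbours
of `i` one removes the `F` largest values among those larger than `x i` (all of them if there are
fewer than `F`), and likewise the `F` smallest values among those smaller than `x i`. -/
def IsRetained (G : SimpleGraph V) (F : ℕ) (x : V → ℝ) (i : V) (R : Finset V) : Prop :=
  ∃ U L : Finset V,
    IsLargestPart F x ((nbrs G i).filter fun j => x i < x j) U ∧
    IsLargestPart F (fun j => -x j) ((nbrs G i).filter fun j => x j < x i) L ∧
    R = nbrs G i \ (U ∪ L)

/-- `c k i` is the value shared by robot `i` at step `k`. Every robot outside the set `A` of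
non-cooperative robots performs the W-MSR update with parameter `F`, with retained neighbour sets
`R` and weights `w` that sum to one and are at least `α` on the robot and its retained neighbours.
Nothing is asked of the values of the robots in `A`, except that every robot has a single value at
each step, which it shares with all its neighbours. -/
structure IsWMSRRun (G : SimpleGraph V) (F : ℕ) (A : Finset V) (α : ℝ)
    (R : ℕ → V → Finset V) (w : ℕ → V → V → ℝ) (c : ℕ → V → ℝ) : Prop where
  retained : ∀ k, ∀ i ∉ A, IsRetained G F (c k) i (R k i)
  weight_self : ∀ k, ∀ i ∉ A, α ≤ w k i i
  weight_nbr : ∀ k, ∀ i ∉ A, ∀ j ∈ R k i, α ≤ w k i j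
  weight_sum : ∀ k, ∀ i ∉ A, w k i i + ∑ j ∈ R k i, w k i j = 1
  update : ∀ k, ∀ i ∉ A, c (k + 1) i = w k i i * c k i + ∑ j ∈ R k i, w k i j * c k j

/-- On `G`, W-MSR with parameter `F` rejects non-cooperative robots under the `F`-global threat
model: whenever at most `F` robots are non-cooperative, the cooperative robots converge to a common
value that lies between the minimum and the maximum of their own initial values. -/
def WMSRRejectsGlobal (G : SimpleGraph V) (F : ℕ) : Prop :=
  ∀ (A : Finset V) (α : ℝ) (R : ℕ → V → Finset V) (w : ℕ → V → V → ℝ) (c : ℕ → V → ℝ),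
    A.card ≤ F → 0 < α → IsWMSRRun G F A α R w c →
    ∃ cs : ℝ, (∀ i ∉ A, Tendsto (fun k => c k i) atTop (𝓝 cs)) ∧
      (∃ i ∉ A, c 0 i ≤ cs) ∧ (∃ i ∉ A, cs ≤ c 0 i)

end WMSR

section Delaunay

variable {V : Type*}

/-- The Euclidean plane. -/
abbrev Plane : Type := EuclideanSpace ℝ (Fin 2)

/-- The (closed) Voronoi cell of robot `i`, for robots at the positions `p`. -/
def voronoiCell (p : V → Plane) (i : V) : Set Plane :=
  {x | ∀ j, dist x (p i) ≤ dist x (p j)}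

/-- Distinct robots are joined when their Voronoi cells are adjacent, that is, have a point in
common. -/
def voronoiGraph (p : V → Plane) : SimpleGraph V where
  Adj i j := i ≠ j ∧ (voronoiCell p i ∩ voronoiCell p j).Nonempty
  symm := ⟨fun _ _ h => ⟨h.1.symm, by rw [Set.inter_comm]; exact h.2⟩⟩
  loopless := ⟨fun _ h => h.1 rfl⟩

/-- `K` is a Delaunay triangulation of the points `p`: a triangulation of their convex hull whose
vertices are exactly these points, such that no point lies strictly inside the circumcircle of a
triangle of `K`. -/
structure IsDelaunayTriangulation (p : V → Plane) (K : Geometry.SimplicialComplex ℝ Plane) :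
    Prop where
  vertices_eq : K.vertices = Set.range p
  space_eq : K.space = convexHull ℝ (Set.range p)
  empty_circumcircle : ∀ t ∈ K.faces, t.card = 3 →
    ∃ (o : Plane) (ρ : ℝ), (∀ x ∈ t, dist x o = ρ) ∧ ∀ j, ρ ≤ dist (p j) o

open Classical in
/-- The communication graph formed by the edges of a triangulation `K` of the points `p`. -/
def edgeGraph (p : V → Plane) (K : Geometry.SimplicialComplex ℝ Plane) : SimpleGraph V where
  Adj i j := i ≠ j ∧ ({p i, p j} : Finset Plane) ∈ K.faces
  symm := ⟨fun _ _ h => ⟨h.1.symm, by rw [Finset.pair_comm]; exact h.2⟩⟩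
  loopless := ⟨fun _ h => h.1 rfl⟩

/-- `G` is a communication graph `𝒢_Δ` of robots at the positions `p`: the graph that joins robots
with adjacent Voronoi cells, or the edge graph of a Delaunay triangulation of the positions. (If no
four positions are concyclic, these coincide; otherwise, there can be several Delaunay
triangulations, and each is allowed.) -/
def IsDelaunayGraph (p : V → Plane) (G : SimpleGraph V) : Prop :=
  G = voronoiGraph p ∨ ∃ K, IsDelaunayTriangulation p K ∧ G = edgeGraph p K

end Delaunay

theorem Convex.exists_continuous_injective_range_eq_interior {E : Type*} [NormedAddCommGroup E]
    [InnerProductSpace ℝ E] {s : Set E} (hs : Convex ℝ s) (hb : Bornology.IsBounded s)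
    (hne : (interior s).Nonempty) :
    ∃ g : E → E, Continuous g ∧ Function.Injective g ∧ Set.range g = interior s := by
  obtain ⟨e, he, -, -⟩ := exists_homeomorph_image_interior_closure_frontier_eq_unitBall hs hne hb
  refine ⟨e.symm ∘ (fun x => ((Homeomorph.unitBall x : Metric.ball (0 : E) 1) : E)),
    e.symm.continuous.comp (continuous_subtype_val.comp Homeomorph.unitBall.continuous),
    e.symm.injective.comp (Subtype.val_injective.comp Homeomorph.unitBall.injective), ?_⟩
  have hr : Set.range (fun x => ((Homeomorph.unitBall x : Metric.ball (0 : E) 1) : E)) =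
      Metric.ball 0 1 := by
    have := Homeomorph.unitBall (E := E).surjective.range_comp
      (Subtype.val : Metric.ball (0 : E) 1 → E)
    rw [Subtype.range_coe] at this
    exact this
  rw [Set.range_comp, hr, ← he, ← Set.image_comp]
  simp

theorem Convex.isConnected_interior_diff_countable {E : Type*} [NormedAddCommGroup E]
    [InnerProductSpace ℝ E] (hE : 1 < Module.rank ℝ E) {s t : Set E} (hs : Convex ℝ s)
    (hb : Bornology.IsBounded s) (hne : (interior s).Nonempty) (ht : t.Countable) :
    IsConnected (interior s \ t) := by
  obtain ⟨g, hc, hi, hr⟩ := hs.exists_continuous_injective_range_eq_interior hb hne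
  have h := ((ht.preimage hi).isConnected_compl_of_one_lt_rank hE).image g hc.continuousOn
  rwa [← Set.preimage_compl, Set.image_preimage_eq_inter_range, hr, Set.inter_comm,
    ← Set.sdiff_eq] at h

theorem exists_weights_of_mem_convexHull_image {V E : Type*} [Fintype V] [AddCommGroup E]
    [Module ℝ E] {p : V → E} {D : Finset V} {q : E} (hq : q ∈ convexHull ℝ (p '' (D : Set V))) :
    ∃ w : V → ℝ, (∀ i, 0 ≤ w i) ∧ (∀ i ∉ D, w i = 0) ∧ ∑ i, w i = 1 ∧ ∑ i, w i • p i = q := by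
  classical
  let C : Set E := {q | ∃ w : V → ℝ, (∀ i, 0 ≤ w i) ∧ (∀ i ∉ D, w i = 0) ∧ ∑ i, w i = 1 ∧
    ∑ i, w i • p i = q}
  have hC : Convex ℝ C := by
    rintro _ ⟨w, h0, hD, h1, rfl⟩ _ ⟨w', h0', hD', h1', rfl⟩ a b ha hb hab
    refine ⟨fun i => a * w i + b * w' i, fun i => ?_, fun i hi => ?_, ?_, ?_⟩
    · have := h0 i; have := h0' i; positivity
    · simp [hD i hi, hD' i hi]
    · rw [Finset.sum_add_distrib, ← Finset.mul_sum, ← Finset.mul_sum, h1, h1', mul_one, mul_one, hab]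
    · simp only [add_smul, mul_smul, Finset.sum_add_distrib, Finset.smul_sum]
  refine convexHull_min ?_ hC hq
  rintro _ ⟨i, hi, rfl⟩
  refine ⟨Pi.single i 1, fun j => ?_, fun j hj => ?_, ?_, ?_⟩
  · by_cases h : j = i
    · subst h; simp
    · simp [h]
  · have : j ≠ i := fun h => hj (h ▸ hi)
    simp [this]
  · simp
  · simp [Pi.single_apply]

theorem sum_smul_mem_convexHull_image {V E : Type*} [Fintype V] [AddCommGroup E]
    [Module ℝ E] {p : V → E} {D : Finset V} {w : V → ℝ} (h0 : ∀ i, 0 ≤ w i)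
    (hD : ∀ i ∉ D, w i = 0) (h1 : ∑ i, w i = 1) :
    ∑ i, w i • p i ∈ convexHull ℝ (p '' (D : Set V)) := by
  rw [← Finset.sum_subset (Finset.subset_univ D) (fun i _ hi => by simp [hD i hi])]
  refine (convex_convexHull ℝ _).sum_mem (fun i _ => h0 i) ?_
    (fun i hi => subset_convexHull ℝ _ ⟨i, hi, rfl⟩)
  rw [← h1]
  exact Finset.sum_subset (Finset.subset_univ D) (fun i _ hi => hD i hi)

/-- A subdivision of the convex hull of the points `p` into cells, each given by the set of its
vertices, whose intersections are common faces. -/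
structure IsSubdivision {V : Type*} [Fintype V] (p : V → Plane) (𝒟 : Set (Finset V)) : Prop where
  covers : ∀ q ∈ interior (convexHull ℝ (Set.range p)),
    ∃ D ∈ 𝒟, q ∈ convexHull ℝ (p '' (D : Set V))
  singleton_mem : ∀ i, {i} ∈ 𝒟
  face : ∀ D ∈ 𝒟, ∀ D' ∈ 𝒟, ∀ w : V → ℝ, (∀ i, 0 ≤ w i) → (∀ i ∉ D, w i = 0) → ∑ i, w i = 1 →
    ∑ i, w i • p i ∈ convexHull ℝ (p '' (D' : Set V)) → ∀ i, w i ≠ 0 → i ∈ D'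

namespace IsSubdivision

variable {V : Type*} {p : V → Plane} {𝒟 : Set (Finset V)}

/-- The part of the plane covered by the cells with a given property. -/
def region (p : V → Plane) (𝒟 : Set (Finset V)) (P : Finset V → Prop) : Set Plane :=
  ⋃ D ∈ {D | D ∈ 𝒟 ∧ P D}, convexHull ℝ (p '' (D : Set V))

theorem mem_region {P : Finset V → Prop} {q : Plane} :
    q ∈ region p 𝒟 P ↔ ∃ D ∈ 𝒟, P D ∧ q ∈ convexHull ℝ (p '' (D : Set V)) := by
  simp [region, and_assoc]

variable [Fintype V]

theorem mem_of_point_mem (h : IsSubdivision p 𝒟) {D : Finset V} (hD : D ∈ 𝒟) {i : V}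
    (hi : p i ∈ convexHull ℝ (p '' (D : Set V))) : i ∈ D := by
  classical
  refine h.face {i} (h.singleton_mem i) D hD (Pi.single i 1) (fun j => ?_) (fun j hj => ?_) ?_ ?_ i
    (by simp)
  · by_cases h : j = i
    · subst h; simp
    · simp [h]
  · have : j ≠ i := by simpa using hj
    simp [this]
  · simp
  · simpa [Pi.single_apply] using hi

theorem interior_nonempty (hcol : ¬ Collinear ℝ (Set.range p)) :
    (interior (convexHull ℝ (Set.range p))).Nonempty := by
  rw [interior_convexHull_nonempty_iff_affineSpan_eq_top]
  have h2 : Module.finrank ℝ Plane = 1 + 1 := by simp [Plane]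
  have hne : (Set.range p).Nonempty := by
    by_contra hemp
    exact hcol (Set.not_nonempty_iff_eq_empty.1 hemp ▸ collinear_empty ℝ Plane)
  rw [AffineSubspace.affineSpan_eq_top_iff_vectorSpan_eq_top_of_nonempty ℝ Plane Plane hne]
  refine Submodule.eq_top_of_finrank_eq (le_antisymm (Submodule.finrank_le _) ?_)
  rw [collinear_iff_finrank_le_one] at hcol
  omega

theorem isClosed_region (P : Finset V → Prop) : IsClosed (region p 𝒟 P) :=
  (Set.toFinite _).isClosed_biUnion fun D _ =>
    ((D.finite_toSet.image p).isCompact_convexHull ℝ).isClosed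

theorem convexHull_subset_of_interior_diff_subset (hcol : ¬ Collinear ℝ (Set.range p))
    {X F : Set Plane} (hX : IsClosed X) (hF : Dense Fᶜ)
    (h : interior (convexHull ℝ (Set.range p)) \ F ⊆ X) : convexHull ℝ (Set.range p) ⊆ X := by
  have h1 : interior (convexHull ℝ (Set.range p)) ⊆ X :=
    (hF.open_subset_closure_inter isOpen_interior).trans (closure_minimal h hX)
  have h2 := (convex_convexHull ℝ (Set.range p)).closure_interior_eq_closure_of_nonempty_interior
    (interior_nonempty hcol)
  exact subset_closure.trans (h2 ▸ closure_minimal h1 hX)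

/-- If a set of cells and its complement have only vertices in common, one of them covers
everything. -/
theorem region_dichotomy (h : IsSubdivision p 𝒟) (hcol : ¬ Collinear ℝ (Set.range p))
    (P : Finset V → Prop)
    (hP : ∀ D ∈ 𝒟, ∀ D' ∈ 𝒟, P D → ¬ P D' → ∀ i ∈ D, ∀ j ∈ D, i ∈ D' → j ∈ D' → i = j) :
    convexHull ℝ (Set.range p) ⊆ region p 𝒟 P ∨
      convexHull ℝ (Set.range p) ⊆ region p 𝒟 (fun D => ¬ P D) := by
  have hcount : (Set.range p).Countable := (Set.finite_range p).countable
  have hconn := (convex_convexHull ℝ (Set.range p)).isConnected_interior_diff_countable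
    (by rw [rank_eq_card_basis (EuclideanSpace.basisFun (Fin 2) ℝ).toBasis]; norm_num)
    (isBounded_convexHull.2 (Set.finite_range p).isBounded) (interior_nonempty hcol) hcount
  have hcl := isPreconnected_closed_iff.1 hconn.isPreconnected (region p 𝒟 P)
    (region p 𝒟 fun D => ¬ P D) (isClosed_region _) (isClosed_region _) (fun q hq => ?_)
  · by_contra! hcon
    have hd : Dense (Set.range p)ᶜ := hcount.dense_compl ℝ
    have ne : ∀ Q R : Finset V → Prop, (∀ D, Q D ∨ R D) →
        ¬ convexHull ℝ (Set.range p) ⊆ region p 𝒟 Q →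
        ((interior (convexHull ℝ (Set.range p)) \ Set.range p) ∩ region p 𝒟 R).Nonempty := by
      intro Q R hQR hn
      by_contra hemp
      refine hn (convexHull_subset_of_interior_diff_subset hcol (isClosed_region _) hd
        fun q hq => ?_)
      obtain ⟨D, hD, hqD⟩ := h.covers q hq.1
      rcases hQR D with hQ | hR
      · exact mem_region.2 ⟨D, hD, hQ, hqD⟩
      · exact absurd ⟨q, hq, mem_region.2 ⟨D, hD, hR, hqD⟩⟩ hemp
    obtain ⟨q, hq, hq1, hq2⟩ := hcl (ne _ _ (fun D => (em (P D)).symm) hcon.2)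
      (ne _ _ (fun D => em (P D)) hcon.1)
    obtain ⟨D, hD, hPD, hqD⟩ := mem_region.1 hq1
    obtain ⟨D', hD', hPD', hqD'⟩ := mem_region.1 hq2
    obtain ⟨w, h0, hw, h1, rfl⟩ := exists_weights_of_mem_convexHull_image hqD
    have hf := h.face D hD D' hD' w h0 hw h1 hqD'
    obtain ⟨i, -, hi⟩ := Finset.exists_ne_zero_of_sum_ne_zero (h1.trans_ne one_ne_zero)
    have hwj : ∀ j, j ≠ i → w j = 0 := fun j hj => by
      by_contra hj0
      exact hj (hP D hD D' hD' hPD hPD' j (by_contra fun h => hj0 (hw j h)) i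
        (by_contra fun h => hi (hw i h)) (hf j hj0) (hf i hi))
    have hwi : w i = 1 := by
      rw [← h1]; exact (Fintype.sum_eq_single i hwj).symm
    refine hq.2 ⟨i, ?_⟩
    rw [Fintype.sum_eq_single i (fun j hj => by simp [hwj j hj]), hwi, one_smul]
  · obtain ⟨D, hD, hqD⟩ := h.covers q hq.1
    by_cases hPD : P D
    · exact Or.inl (mem_region.2 ⟨D, hD, hPD, hqD⟩)
    · exact Or.inr (mem_region.2 ⟨D, hD, hPD, hqD⟩)

/-- No vertex has all its cells on a single edge. -/
theorem exists_cell_not_subset_pair [DecidableEq V] (h : IsSubdivision p 𝒟)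
    (hcol : ¬ Collinear ℝ (Set.range p))
    (i j : V) : ∃ D ∈ 𝒟, i ∈ D ∧ ¬ D ⊆ {i, j} := by
  by_contra! hcon
  have hd : Dense (convexHull ℝ {p i, p j})ᶜ := by
    rw [← interior_eq_empty_iff_dense_compl]
    by_contra hne
    have ht := interior_convexHull_nonempty_iff_affineSpan_eq_top.1
      (Set.nonempty_iff_ne_empty.2 hne)
    have := (collinear_iff_finrank_le_one (k := ℝ) (s := ({p i, p j} : Set Plane))).1
      (collinear_pair ℝ _ _)
    rw [← direction_affineSpan, ht, AffineSubspace.direction_top, finrank_top] at this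
    simp [Plane] at this
  have hsub := convexHull_subset_of_interior_diff_subset hcol
    (isClosed_region (p := p) (𝒟 := 𝒟) fun D => i ∉ D) hd (fun q hq => by
      obtain ⟨D, hD, hqD⟩ := h.covers q hq.1
      refine mem_region.2 ⟨D, hD, fun hi => hq.2 (convexHull_mono ?_ hqD), hqD⟩
      rintro _ ⟨k, hk, rfl⟩
      have := hcon D hD hi hk
      simp only [Finset.mem_insert, Finset.mem_singleton] at this
      rcases this with rfl | rfl <;> simp)
  obtain ⟨D, hD, hiD, hq⟩ := mem_region.1 (hsub (subset_convexHull ℝ _ ⟨i, rfl⟩))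
  exact hiD (h.mem_of_point_mem hD hq)

theorem isRSRobust (h : IsSubdivision p 𝒟) (hcol : ¬ Collinear ℝ (Set.range p))
    {G : SimpleGraph V} (hG : ∀ i j, G.Adj i j ↔ i ≠ j ∧ ∃ D ∈ 𝒟, i ∈ D ∧ j ∈ D) :
    IsRSRobust G 2 2 := by
  classical
  have key : ∀ S T : Finset V, S.Nonempty → Disjoint S T → reachable G 2 S = ∅ →
      reachable G 2 T = T := by
    intro S T hS hST hr
    have hS2 : ∀ i ∈ S, ∀ a ∉ S, ∀ b ∉ S, G.Adj i a → G.Adj i b → a = b := by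
      intro i hi a ha b hb hia hib
      by_contra hab
      have : i ∈ reachable G 2 S := by
        refine Finset.mem_filter.2 ⟨hi, ?_⟩
        rw [← Finset.card_pair hab]
        refine Finset.card_le_card fun x hx => ?_
        rcases Finset.mem_insert.1 hx with rfl | hx
        · simp [nbrs, hia, ha]
        · rw [Finset.mem_singleton.1 hx]; simp [nbrs, hib, hb]
      simp [hr] at this
    have hmix : ∀ D ∈ 𝒟, ¬ Disjoint D S → ∀ a ∈ D, ∀ b ∈ D, a ∉ S → b ∉ S → a = b := by
      intro D hD hDS a ha b hb haS hbS
      obtain ⟨i, hiD, hiS⟩ := Finset.not_disjoint_iff.1 hDS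
      exact hS2 i hiS a haS b hbS
        ((hG i a).2 ⟨fun e => haS (e ▸ hiS), D, hD, hiD, ha⟩)
        ((hG i b).2 ⟨fun e => hbS (e ▸ hiS), D, hD, hiD, hb⟩)
    have hind : ∀ a b, a ∉ S → b ∉ S → ¬ G.Adj a b := by
      intro a b ha hb hab
      obtain ⟨hne, D, hD, haD, hbD⟩ := (hG a b).1 hab
      rcases h.region_dichotomy hcol (fun D => ∃ a ∈ D, ∃ b ∈ D, a ∉ S ∧ b ∉ S ∧ a ≠ b) (by
        rintro D hD D' hD' ⟨a, ha, b, hb, haS, hbS, hab⟩ hn i hi j hj hi' hj'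
        have hdis : Disjoint D S := by
          by_contra hdis; exact hab (hmix D hD hdis a ha b hb haS hbS)
        by_contra hij
        exact hn ⟨i, hi', j, hj', Finset.disjoint_left.1 hdis hi, Finset.disjoint_left.1 hdis hj,
          hij⟩) with hsub | hsub
      · obtain ⟨s, hs⟩ := hS
        obtain ⟨D, hD, ⟨a, ha, b, hb, haS, hbS, hab⟩, hq⟩ :=
          mem_region.1 (hsub (subset_convexHull ℝ _ ⟨s, rfl⟩))
        exact hab (hmix D hD (Finset.not_disjoint_iff.2 ⟨s, h.mem_of_point_mem hD hq, hs⟩)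
          a ha b hb haS hbS)
      · let w : V → ℝ := fun i => if i = a ∨ i = b then 1 / 2 else 0
        have hw : ∀ i, w i = (if i = a then 1 / 2 else 0) + (if i = b then 1 / 2 else 0) := by
          intro i
          by_cases h1 : i = a
          · subst h1; simp [w, hne]
          · simp [w, h1]
        have h0 : ∀ i, 0 ≤ w i := fun i => by simp only [w]; split_ifs <;> norm_num
        have hwD : ∀ i ∉ D, w i = 0 := by
          intro i hi
          have : ¬ (i = a ∨ i = b) := by rintro (rfl | rfl) <;> contradiction
          simp [w, this]
        have h1 : ∑ i, w i = 1 := by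
          simp only [hw, Finset.sum_add_distrib]; simp; norm_num
        have hmem := sum_smul_mem_convexHull_image (p := p) h0 hwD h1
        obtain ⟨D', hD', hn, hq⟩ := mem_region.1
          (hsub (convexHull_mono (Set.image_subset_range _ _) hmem))
        have hf := h.face D hD D' hD' w h0 hwD h1 hq
        exact hn ⟨a, hf a (by simp [w]), b, hf b (by simp [w]), ha, hb, hne⟩
    refine Finset.filter_true_of_mem fun t ht => ?_
    have htS : t ∉ S := fun hs => Finset.disjoint_left.1 hST hs ht
    have hnb : ∀ j, ∃ k, k ≠ j ∧ G.Adj t k := by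
      intro j
      obtain ⟨D, hD, htD, hn⟩ := h.exists_cell_not_subset_pair hcol t j
      obtain ⟨k, hk, hk'⟩ := Finset.not_subset.1 hn
      simp only [Finset.mem_insert, Finset.mem_singleton, not_or] at hk'
      exact ⟨k, hk'.2, (hG t k).2 ⟨Ne.symm hk'.1, D, hD, htD, hk⟩⟩
    obtain ⟨j, -, hj⟩ := hnb t
    obtain ⟨k, hkj, hk⟩ := hnb j
    have hout : ∀ x, G.Adj t x → x ∈ nbrs G t \ T := fun x hx => by
      simp only [nbrs, Finset.mem_sdiff, Finset.mem_filter, Finset.mem_univ, true_and]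
      refine ⟨hx, fun hxT => hind t x htS (fun hs => Finset.disjoint_left.1 hST hs hxT) hx⟩
    rw [← Finset.card_pair hkj]
    refine Finset.card_le_card fun x hx => ?_
    rcases Finset.mem_insert.1 hx with rfl | hx
    · exact hout _ hk
    · rw [Finset.mem_singleton.1 hx]; exact hout _ hj
  intro S₁ S₂ h1 h2 hdis
  rcases (reachable G 2 S₁).eq_empty_or_nonempty with e1 | e1
  · exact Or.inr (Or.inl (by rw [key S₁ S₂ h1 hdis e1]))
  rcases (reachable G 2 S₂).eq_empty_or_nonempty with e2 | e2
  · exact Or.inl (by rw [key S₂ S₁ h2 hdis.symm e2])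
  · exact Or.inr (Or.inr (by have := e1.card_pos; have := e2.card_pos; omega))

end IsSubdivision

section VoronoiSubdivision

variable {V : Type*} [Fintype V]

open Classical in
/-- The sites nearest to `x`. -/
noncomputable def nearestSites (p : V → Plane) (x : Plane) : Finset V :=
  Finset.univ.filter fun i => x ∈ voronoiCell p i

theorem mem_nearestSites {p : V → Plane} {x : Plane} {i : V} :
    i ∈ nearestSites p x ↔ ∀ j, dist x (p i) ≤ dist x (p j) := by
  simp only [nearestSites, Finset.mem_filter, Finset.mem_univ, true_and]
  rfl

theorem sum_weights_mul_dist_sq_sub {p : V → Plane} {w : V → ℝ} (h1 : ∑ i, w i = 1)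
    (x y : Plane) :
    ∑ i, w i * (dist x (p i) ^ 2 - dist y (p i) ^ 2) =
      ‖x‖ ^ 2 - ‖y‖ ^ 2 - 2 * inner ℝ (x - y) (∑ i, w i • p i) := by
  have e : ∀ i, w i * (dist x (p i) ^ 2 - dist y (p i) ^ 2) =
      w i * (‖x‖ ^ 2 - ‖y‖ ^ 2) - 2 * inner ℝ (x - y) (w i • p i) := by
    intro i
    rw [dist_eq_norm, dist_eq_norm, norm_sub_sq_real, norm_sub_sq_real, inner_smul_right,
      inner_sub_left]
    ring
  simp only [e, Finset.sum_sub_distrib, ← Finset.sum_mul, ← Finset.mul_sum, h1, inner_sum, one_mul]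

theorem mem_nearestSites_of_common_point {p : V → Plane} {x y : Plane} {w w' : V → ℝ}
    (h0 : ∀ i, 0 ≤ w i) (hw : ∀ i ∉ nearestSites p x, w i = 0) (h1 : ∑ i, w i = 1)
    (h0' : ∀ i, 0 ≤ w' i) (hw' : ∀ i ∉ nearestSites p y, w' i = 0) (h1' : ∑ i, w' i = 1)
    (heq : ∑ i, w i • p i = ∑ i, w' i • p i) {i : V} (hi : w i ≠ 0) : i ∈ nearestSites p y := by
  obtain ⟨j, -, hj⟩ := Finset.exists_ne_zero_of_sum_ne_zero (h1'.trans_ne one_ne_zero)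
  have hi' := mem_nearestSites.1 (not_imp_comm.1 (hw i) hi)
  have hj' := mem_nearestSites.1 (not_imp_comm.1 (hw' j) hj)
  have hE : ∀ (z : Plane) (u : V → ℝ) (l : V), (∀ k ∉ nearestSites p z, u k = 0) →
      l ∈ nearestSites p z → ∀ k, u k * dist z (p k) ^ 2 = u k * dist z (p l) ^ 2 := by
    intro z u l hu hl k
    by_cases hk : k ∈ nearestSites p z
    · rw [le_antisymm (mem_nearestSites.1 hk l) (mem_nearestSites.1 hl k)]
    · simp [hu k hk]
  have hx := hE x w i hw (not_imp_comm.1 (hw i) hi)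
  have hy := hE y w' j hw' (not_imp_comm.1 (hw' j) hj)
  have hsum : ∑ k, w k * (dist y (p k) ^ 2 - dist y (p j) ^ 2) +
      ∑ k, w' k * (dist x (p k) ^ 2 - dist x (p i) ^ 2) = 0 := by
    have e1 := sum_weights_mul_dist_sq_sub (p := p) h1 x y
    have e2 := sum_weights_mul_dist_sq_sub (p := p) h1' x y
    rw [heq, ← e2] at e1
    simp only [mul_sub, Finset.sum_sub_distrib, hx, hy, ← Finset.sum_mul, h1, h1'] at e1 ⊢
    linarith
  have hn1 : ∀ k ∈ Finset.univ, 0 ≤ w k * (dist y (p k) ^ 2 - dist y (p j) ^ 2) := fun k _ =>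
    mul_nonneg (h0 k) (sub_nonneg.2 (pow_le_pow_left₀ dist_nonneg (hj' k) 2))
  have hn2 : ∀ k ∈ Finset.univ, 0 ≤ w' k * (dist x (p k) ^ 2 - dist x (p i) ^ 2) := fun k _ =>
    mul_nonneg (h0' k) (sub_nonneg.2 (pow_le_pow_left₀ dist_nonneg (hi' k) 2))
  have hz := (Finset.sum_eq_zero_iff_of_nonneg hn1).1
    (by linarith [Finset.sum_nonneg hn1, Finset.sum_nonneg hn2]) i (Finset.mem_univ i)
  have hd : dist y (p i) ≤ dist y (p j) := (sq_le_sq₀ dist_nonneg dist_nonneg).1 (sub_nonpos.1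
    ((mul_eq_zero.1 hz).resolve_left hi).le)
  exact mem_nearestSites.2 fun k => hd.trans (hj' k)

/-- Every point in the interior of the convex hull is in the convex hull of the sites that are
nearest to some point of the plane. -/
theorem exists_mem_convexHull_nearestSites [Nonempty V] (p : V → Plane) {q : Plane}
    (hq : q ∈ interior (convexHull ℝ (Set.range p))) :
    ∃ x, q ∈ convexHull ℝ (p '' (nearestSites p x : Set V)) := by
  have hne : (Finset.univ : Finset V).Nonempty := Finset.univ_nonempty
  let g : V → Plane → ℝ := fun i x => dist x q ^ 2 - dist x (p i) ^ 2
  have hg : ∀ i x v, g i (x + v) = g i x + 2 * inner ℝ v (p i - q) := by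
    intro i x v
    simp only [g, dist_eq_norm]
    rw [show x + v - q = (x - q) + v by abel, show x + v - p i = (x - q) + v - (p i - q) by abel,
      show x - p i = (x - q) - (p i - q) by abel, norm_sub_sq_real (x - q + v),
      norm_sub_sq_real (x - q) (p i - q), inner_add_left]
    ring
  have hgc : ∀ i, Continuous (g i) := fun i => by fun_prop
  let f : Plane → ℝ := fun x => Finset.univ.sup' hne fun i => g i x
  have hgf : ∀ i x, g i x ≤ f x := fun i x =>
    Finset.le_sup' (fun i => g i x) (Finset.mem_univ i)
  have hfc : Continuous f := Continuous.finset_sup'_apply hne fun i _ => hgc i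
  obtain ⟨r, hr, hball⟩ := Metric.mem_nhds_iff.1 (mem_interior_iff_mem_nhds.1 hq)
  let a : ℝ := Finset.univ.inf' hne fun i => g i 0
  have hcoer : ∀ x, r * ‖x‖ + a ≤ f x := by
    intro x
    rcases eq_or_ne x 0 with rfl | hx
    · obtain ⟨i⟩ := ‹Nonempty V›
      simpa using (Finset.inf'_le (fun i => g i 0) (Finset.mem_univ i)).trans (hgf i 0)
    have hx0 : 0 < ‖x‖ := norm_pos_iff.2 hx
    have hdense : ∀ s < r, 0 < s → 2 * s * ‖x‖ + a ≤ f x := by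
      intro s hs hs0
      have hmem : q + (s / ‖x‖) • x ∈ convexHull ℝ (Set.range p) := by
        refine hball ?_
        rw [Metric.mem_ball, dist_eq_norm, add_sub_cancel_left, norm_smul, Real.norm_eq_abs,
          abs_of_pos (by positivity), div_mul_cancel₀ _ hx0.ne']
        exact hs
      obtain ⟨_, ⟨i, rfl⟩, hi⟩ := ConvexOn.exists_ge_of_mem_convexHull
        ((innerₛₗ ℝ x).convexOn convex_univ) (Set.subset_univ _) hmem
      simp only [innerₛₗ_apply_apply, inner_add_right, inner_smul_right,
        real_inner_self_eq_norm_sq] at hi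
      have e : s / ‖x‖ * ‖x‖ ^ 2 = s * ‖x‖ := by field_simp
      have h1 := hg i 0 x
      rw [zero_add, inner_sub_right] at h1
      have h2 : a ≤ g i 0 := Finset.inf'_le (fun i => g i 0) (Finset.mem_univ i)
      linarith [hgf i x]
    have := hdense (r / 2) (by linarith) (by linarith)
    linarith
  obtain ⟨x, hx⟩ := hfc.exists_forall_le (tendsto_atTop_mono hcoer
    (tendsto_atTop_add_const_right _ a
      ((tendsto_norm_cocompact_atTop (E := Plane)).const_mul_atTop hr)))
  refine ⟨x, by_contra fun hqx => ?_⟩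
  obtain ⟨φ, u, hφ, hu⟩ := geometric_hahn_banach_closed_point (convex_convexHull ℝ _)
    ((((nearestSites p x).finite_toSet.image p).isCompact_convexHull ℝ).isClosed) hqx
  let v : Plane := (InnerProductSpace.toDual ℝ Plane).symm φ
  have hv : ∀ z, inner ℝ v z = φ z := fun z => InnerProductSpace.toDual_symm_apply
  have hev : ∀ i, ∀ᶠ ε : ℝ in 𝓝[>] 0, g i (x + ε • v) < f x := by
    intro i
    by_cases hi : i ∈ nearestSites p x
    · filter_upwards [self_mem_nhdsWithin] with ε hε
      have h1 := hφ (p i) (subset_convexHull ℝ _ ⟨i, hi, rfl⟩)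
      rw [hg, inner_smul_left, hv, map_sub]
      have : ε * (φ (p i) - φ q) < 0 := mul_neg_of_pos_of_neg hε (by linarith)
      have := hgf i x
      simp only [conj_trivial]
      linarith
    · have hlt : g i x < f x := by
        rw [mem_nearestSites] at hi
        push Not at hi
        obtain ⟨j, hj⟩ := hi
        refine lt_of_lt_of_le ?_ (hgf j x)
        have := pow_lt_pow_left₀ hj dist_nonneg two_ne_zero
        simp only [g]
        linarith
      have hc : Continuous fun ε : ℝ => g i (x + ε • v) := (hgc i).comp (by fun_prop)
      have ht := hc.tendsto 0
      simp only [zero_smul, add_zero] at ht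
      exact (ht.eventually_lt_const hlt).filter_mono nhdsWithin_le_nhds
  obtain ⟨ε, hε⟩ := (eventually_all.2 hev).exists
  exact (hx (x + ε • v)).not_gt ((Finset.sup'_lt_iff hne).2 fun i _ => hε i)

theorem isSubdivision_nearestSites [Nonempty V] {p : V → Plane} (hp : Function.Injective p) :
    IsSubdivision p (Set.range (nearestSites p)) where
  covers q hq := by
    obtain ⟨x, hx⟩ := exists_mem_convexHull_nearestSites p hq
    exact ⟨_, ⟨x, rfl⟩, hx⟩
  singleton_mem i := by
    refine ⟨p i, Finset.ext fun j => ?_⟩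
    rw [mem_nearestSites, Finset.mem_singleton]
    refine ⟨fun h => ?_, fun h k => ?_⟩
    · have := h i
      rw [dist_self] at this
      exact (hp (dist_le_zero.1 this)).symm
    · rw [h, dist_self]; exact dist_nonneg
  face := by
    rintro _ ⟨x, rfl⟩ _ ⟨y, rfl⟩ w h0 hw h1 hq i hi
    obtain ⟨w', h0', hw', h1', heq⟩ := exists_weights_of_mem_convexHull_image hq
    exact mem_nearestSites_of_common_point h0 hw h1 h0' hw' h1' heq.symm hi

theorem voronoiGraph_adj_iff {p : V → Plane} {i j : V} :
    (voronoiGraph p).Adj i j ↔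
      i ≠ j ∧ ∃ D ∈ Set.range (nearestSites p), i ∈ D ∧ j ∈ D := by
  simp [voronoiGraph, nearestSites, Set.Nonempty]

end VoronoiSubdivision

section Triangulation

variable {V : Type*} {p : V → Plane} {K : Geometry.SimplicialComplex ℝ Plane}

open Classical in
/-- The vertex sets of the simplices of a triangulation of the points `p`. -/
def simplexCells (p : V → Plane) (K : Geometry.SimplicialComplex ℝ Plane) : Set (Finset V) :=
  {D | D.image p ∈ K.faces}

theorem mem_simplexCells [DecidableEq Plane] {D : Finset V} :
    D ∈ simplexCells p K ↔ D.image p ∈ K.faces := by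
  simp only [simplexCells, Set.mem_ofPred_eq]
  convert! Iff.rfl

theorem edgeGraph_adj_iff {i j : V} :
    (edgeGraph p K).Adj i j ↔ i ≠ j ∧ ∃ D ∈ simplexCells p K, i ∈ D ∧ j ∈ D := by
  classical
  refine and_congr_right fun _ => ⟨fun h => ⟨{i, j}, ?_, by simp, by simp⟩, ?_⟩
  · rw [mem_simplexCells, Finset.image_insert, Finset.image_singleton]
    convert h
  · rintro ⟨D, hD, hi, hj⟩
    refine K.down_closed (mem_simplexCells.1 hD) (fun z hz => ?_) (by simp)
    rcases Finset.mem_insert.1 hz with rfl | hz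
    · exact Finset.mem_image_of_mem p hi
    · rw [Finset.mem_singleton.1 hz]; exact Finset.mem_image_of_mem p hj

variable [Fintype V]

theorem AffineIndependent.weights_unique [DecidableEq Plane] (hp : Function.Injective p)
    {D : Finset V}
    (hind : AffineIndependent ℝ ((↑) : D.image p → Plane)) {w w' : V → ℝ} (hw : ∀ i ∉ D, w i = 0)
    (hw' : ∀ i ∉ D, w' i = 0) (h1 : ∑ i, w i = 1) (h1' : ∑ i, w' i = 1)
    (heq : ∑ i, w i • p i = ∑ i, w' i • p i) : w = w' := by
  let e : D ↪ D.image p := ⟨fun j => ⟨p j, Finset.mem_image_of_mem p j.2⟩,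
    fun a b hab => Subtype.ext (hp (congrArg Subtype.val hab))⟩
  have hind : AffineIndependent ℝ fun j : D => p j := hind.comp_embedding e
  have hout : ∀ j ∉ D, w j - w' j = 0 := fun j hj => by rw [hw j hj, hw' j hj, sub_zero]
  funext i
  by_cases hi : i ∈ D
  · refine sub_eq_zero.1 (affineIndependent_iff.1 hind Finset.univ (fun j => w j - w' j) ?_ ?_
      ⟨i, hi⟩ (Finset.mem_univ _))
    · rw [Finset.sum_coe_sort D fun j => w j - w' j,
        Finset.sum_subset (Finset.subset_univ D) fun j _ => hout j, Finset.sum_sub_distrib, h1, h1',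
        sub_self]
    · rw [Finset.sum_coe_sort D fun j => (w j - w' j) • p j,
        Finset.sum_subset (Finset.subset_univ D) fun j _ hj => by rw [hout j hj, zero_smul]]
      simp only [sub_smul, Finset.sum_sub_distrib, heq, sub_self]
  · rw [hw i hi, hw' i hi]

theorem IsDelaunayTriangulation.isSubdivision (h : IsDelaunayTriangulation p K)
    (hp : Function.Injective p) : IsSubdivision p (simplexCells p K) where
  covers q hq := by
    classical
    have hq' := interior_subset hq
    rw [← h.space_eq, Geometry.SimplicialComplex.mem_space_iff] at hq'
    obtain ⟨s, hs, hqs⟩ := hq'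
    have hsub : (s : Set Plane) ⊆ p '' (Finset.univ : Finset V) := by
      intro z hz
      have hz' : z ∈ K.vertices := K.down_closed hs (by simpa using hz) (by simp)
      rw [h.vertices_eq] at hz'
      simpa using hz'
    obtain ⟨D, -, rfl⟩ := Finset.subset_set_image_iff.1 hsub
    exact ⟨D, mem_simplexCells.2 hs, by rwa [Finset.coe_image] at hqs⟩
  singleton_mem i := by
    classical
    have : p i ∈ K.vertices := h.vertices_eq ▸ ⟨i, rfl⟩
    rw [mem_simplexCells, Finset.image_singleton]
    exact this
  face := by
    classical
    intro D hD D' hD' w h0 hw h1 hq i hi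
    have hmem := sum_smul_mem_convexHull_image (p := p) h0 hw h1
    rw [mem_simplexCells] at hD hD'
    have hint := K.inter_subset_convexHull hD hD'
    rw [Finset.coe_image, Finset.coe_image, ← Set.image_inter hp, ← Finset.coe_inter] at hint
    obtain ⟨w', -, hw', h1', heq⟩ := exists_weights_of_mem_convexHull_image (hint ⟨hmem, hq⟩)
    have hww := AffineIndependent.weights_unique hp (K.indep hD) hw
      (fun j hj => hw' j fun h => hj (Finset.mem_inter.1 h).1) h1 h1' heq.symm
    by_contra hiD'
    exact hi (by rw [hww, hw' i fun h => hiD' (Finset.mem_inter.1 h).2])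

end Triangulation

theorem IsDelaunayGraph.isRSRobust {V : Type*} [Fintype V] {p : V → Plane}
    (hp : Function.Injective p) (hcol : ¬ Collinear ℝ (Set.range p)) {G : SimpleGraph V}
    (hG : IsDelaunayGraph p G) : IsRSRobust G 2 2 := by
  have : Nonempty V := by
    by_contra hV
    rw [not_nonempty_iff] at hV
    exact hcol (by rw [Set.range_eq_empty]; exact collinear_empty ℝ Plane)
  rcases hG with rfl | ⟨K, hK, rfl⟩
  · exact (isSubdivision_nearestSites hp).isRSRobust hcol fun _ _ => voronoiGraph_adj_iff
  · exact (hK.isSubdivision hp).isRSRobust hcol fun _ _ => edgeGraph_adj_iff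

theorem weighted_sum_le {V : Type*} {α : ℝ} {S : Finset V} {i : V} {v x : V → ℝ} (hα : 0 ≤ α) (hi : α ≤ v i)
    (hv : ∀ j ∈ S, α ≤ v j) (hsum : v i + ∑ j ∈ S, v j = 1) {b y : ℝ} (hxi : x i ≤ b)
    (hx : ∀ j ∈ S, x j ≤ b) (hy : x i ≤ y ∨ ∃ j ∈ S, x j ≤ y) (hyb : y ≤ b) :
    v i * x i + ∑ j ∈ S, v j * x j ≤ α * y + (1 - α) * b := by
  have e : b - (v i * x i + ∑ j ∈ S, v j * x j) = v i * (b - x i) + ∑ j ∈ S, v j * (b - x j) := by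
    simp only [mul_sub, Finset.sum_sub_distrib, ← Finset.sum_mul]
    linear_combination (-b) * hsum
  have hnn : ∀ j ∈ S, 0 ≤ v j * (b - x j) := fun j hj =>
    mul_nonneg (hα.trans (hv j hj)) (sub_nonneg.2 (hx j hj))
  have key : α * (b - y) ≤ v i * (b - x i) + ∑ j ∈ S, v j * (b - x j) := by
    rcases hy with hy | ⟨j, hj, hy⟩
    · have h1 : α * (b - y) ≤ v i * (b - x i) :=
        mul_le_mul hi (by linarith) (by linarith) (hα.trans hi)
      linarith [Finset.sum_nonneg hnn]
    · have h1 : α * (b - y) ≤ v j * (b - x j) :=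
        mul_le_mul (hv j hj) (by linarith) (by linarith) (hα.trans (hv j hj))
      linarith [Finset.single_le_sum hnn hj, mul_nonneg (hα.trans hi) (sub_nonneg.2 hxi)]
  linarith

section WMSRConvergence

variable {V : Type*} [Fintype V] {G : SimpleGraph V} {F : ℕ} {A : Finset V} {α : ℝ}
  {R : ℕ → V → Finset V} {w : ℕ → V → V → ℝ} {c : ℕ → V → ℝ}

theorem IsRetained.neg {x : V → ℝ} {i : V} {S : Finset V} (h : IsRetained G F x i S) :
    IsRetained G F (fun j => -x j) i S := by
  classical
  obtain ⟨U, L, hU, hL, rfl⟩ := h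
  refine ⟨L, U, ?_, ?_, ?_⟩
  · simpa only [neg_lt_neg_iff] using hL
  · simpa only [neg_lt_neg_iff, neg_neg] using hU
  · rw [Finset.union_comm]

/-- No retained value exceeds all cooperative values. -/
theorem IsRetained.le_of_mem {x : V → ℝ} {i : V} {S : Finset V} (h : IsRetained G F x i S)
    (hA : A.card ≤ F) {b : ℝ} (hi : x i ≤ b) (hb : ∀ j ∉ A, x j ≤ b) {j : V} (hj : j ∈ S) :
    x j ≤ b := by
  classical
  obtain ⟨U, L, ⟨hUB, hUc, hU⟩, -, rfl⟩ := h
  by_contra! hlt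
  have hjn := (Finset.mem_sdiff.1 hj).1
  have hjU : j ∉ U := fun h => (Finset.mem_sdiff.1 hj).2 (Finset.mem_union_left _ h)
  have hjB : j ∈ (nbrs G i).filter fun j => x i < x j :=
    Finset.mem_filter.2 ⟨hjn, hi.trans_lt hlt⟩
  have hsub : insert j U ⊆ A := by
    intro k hk
    by_contra hkA
    rcases Finset.mem_insert.1 hk with rfl | hk
    · exact (hb k hkA).not_gt hlt
    · exact ((hU k hk j hjB hjU).trans (hb k hkA)).not_gt hlt
  have h1 := Finset.card_le_card hsub
  rw [Finset.card_insert_of_notMem hjU] at h1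
  have h2 := Finset.card_lt_card (Finset.ssubset_iff_subset_ne.2 ⟨hUB, fun e => hjU (e ▸ hjB)⟩)
  omega

/-- Of more than `F` neighbours with values below that of `i`, one is retained. -/
theorem IsRetained.exists_mem {x : V → ℝ} {i : V} {S : Finset V} (h : IsRetained G F x i S)
    {N : Finset V} (hN : N ⊆ nbrs G i) (hlt : ∀ j ∈ N, x j < x i) (hc : F < N.card) :
    ∃ j ∈ N, j ∈ S := by
  classical
  obtain ⟨U, L, ⟨hU, -, -⟩, ⟨-, hL, -⟩, rfl⟩ := h
  obtain ⟨j, hjN, hjL⟩ := Finset.exists_mem_notMem_of_card_lt_card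
    ((hL.trans_le (min_le_left _ _)).trans_lt hc)
  refine ⟨j, hjN, Finset.mem_sdiff.2 ⟨hN hjN, fun hj => ?_⟩⟩
  rcases Finset.mem_union.1 hj with hj | hj
  · exact lt_asymm (hlt j hjN) (Finset.mem_filter.1 (hU hj)).2
  · exact hjL hj

namespace IsWMSRRun

theorem neg (h : IsWMSRRun G F A α R w c) : IsWMSRRun G F A α R w (fun k i => -c k i) where
  retained k i hi := (h.retained k i hi).neg
  weight_self := h.weight_self
  weight_nbr := h.weight_nbr
  weight_sum := h.weight_sum
  update k i hi := by
    simp only [mul_neg, Finset.sum_neg_distrib, h.update k i hi]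
    ring

theorem update_le (h : IsWMSRRun G F A α R w c) (hA : A.card ≤ F) (hα : 0 < α) {k : ℕ} {b y : ℝ}
    (hb : ∀ j ∉ A, c k j ≤ b) (hyb : y ≤ b) {i : V} (hi : i ∉ A)
    (hy : c k i ≤ y ∨ ∃ j ∈ R k i, c k j ≤ y) : c (k + 1) i ≤ α * y + (1 - α) * b := by
  rw [h.update k i hi]
  exact weighted_sum_le hα.le (h.weight_self k i hi) (h.weight_nbr k i hi) (h.weight_sum k i hi)
    (hb i hi) (fun j hj => (h.retained k i hi).le_of_mem hA (hb i hi) hb hj) hy hyb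

theorem update_le_bound (h : IsWMSRRun G F A α R w c) (hA : A.card ≤ F) (hα : 0 < α) {k : ℕ}
    {b : ℝ} (hb : ∀ j ∉ A, c k j ≤ b) {i : V} (hi : i ∉ A) : c (k + 1) i ≤ b := by
  have := h.update_le hA hα hb le_rfl hi (Or.inl (hb i hi))
  linarith

open Classical in
/-- The cooperative robots whose value exceeds a threshold. -/
noncomputable def above (A : Finset V) (x : V → ℝ) (y : ℝ) : Finset V :=
  Finset.univ.filter fun i => i ∉ A ∧ y < x i

/-- The set of cooperative robots above a slowly decreasing threshold shrinks, and it shrinks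
strictly if one of them has more than `F` neighbours below the threshold. -/
theorem above_succ (h : IsWMSRRun G F A α R w c) (hA : A.card ≤ F) (hα : 0 < α) {k : ℕ}
    {b y y' : ℝ} (hb : ∀ j ∉ A, c k j ≤ b) (hyb : y ≤ b) (hy' : α * y + (1 - α) * b ≤ y') :
    above A (c (k + 1)) y' ⊆ above A (c k) y ∧
    ∀ i ∈ above A (c k) y, (∃ j ∈ R k i, c k j ≤ y) → i ∉ above A (c (k + 1)) y' := by
  simp only [above, Finset.subset_iff, Finset.mem_filter, Finset.mem_univ, true_and]
  refine ⟨fun i ⟨hi, hlt⟩ => ⟨hi, ?_⟩, fun i hi hj hlt => ?_⟩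
  · by_contra! hle
    linarith [h.update_le hA hα hb hyb hi (Or.inl hle)]
  · linarith [h.update_le hA hα hb hyb hi.1 (Or.inr hj), hlt.2]

open Classical in
theorem exists_retained_of_mem_reachable (h : IsWMSRRun G F A α R w c) {k : ℕ} {y : ℝ} {i : V}
    (hi : i ∉ A)
    (hr : i ∈ reachable G (F + 1) (Finset.univ.filter fun j => y < c k j)) :
    i ∈ above A (c k) y ∧ ∃ j ∈ R k i, c k j ≤ y := by
  obtain ⟨hiS, hcard⟩ := Finset.mem_filter.1 hr
  have hyi : y < c k i := (Finset.mem_filter.1 hiS).2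
  have hle : ∀ j ∈ nbrs G i \ (Finset.univ.filter fun j => y < c k j), c k j ≤ y := by
    intro j hj
    simpa using (Finset.mem_sdiff.1 hj).2
  obtain ⟨j, hj, hjR⟩ := (h.retained k i hi).exists_mem (Finset.sdiff_subset)
    (fun j hj => (hle j hj).trans_lt hyi) (by convert! Nat.lt_of_succ_le hcard)
  exact ⟨by simp [above, hi, hyi], j, hjR, hle j hj⟩

end IsWMSRRun

/-- In a robust network, one cooperative robot of two disjoint sets, each with a cooperative robot,
has more than `F` neighbours outside its set. -/
theorem IsRSRobust.exists_cooperative (hG : IsRSRobust G (F + 1) (F + 1)) (hA : A.card ≤ F)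
    {S T : Finset V} (hd : Disjoint S T) (hS : ∃ i ∈ S, i ∉ A) (hT : ∃ i ∈ T, i ∉ A) :
    ∃ i ∉ A, i ∈ reachable G (F + 1) S ∨ i ∈ reachable G (F + 1) T := by
  classical
  obtain ⟨s, hs, hsA⟩ := hS
  obtain ⟨t, ht, htA⟩ := hT
  have hsub : ∀ X : Finset V, reachable G (F + 1) X ⊆ X := fun X => Finset.filter_subset _ _
  rcases hG S T ⟨s, hs⟩ ⟨t, ht⟩ hd with h | h | h
  · exact ⟨s, hsA, Or.inl ((Finset.eq_of_subset_of_card_le (hsub S) h.ge).ge hs)⟩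
  · exact ⟨t, htA, Or.inr ((Finset.eq_of_subset_of_card_le (hsub T) h.ge).ge ht)⟩
  · rw [← Finset.card_union_of_disjoint (hd.mono (hsub S) (hsub T))] at h
    obtain ⟨i, hi, hiA⟩ := Finset.exists_mem_notMem_of_card_lt_card (hA.trans_lt h)
    exact ⟨i, hiA, Finset.mem_union.1 hi⟩

namespace IsWMSRRun

theorem step_card (h : IsWMSRRun G F A α R w c) (hG : IsRSRobust G (F + 1) (F + 1))
    (hA : A.card ≤ F) (hα : 0 < α) {k : ℕ} {b y y' d z z' : ℝ}
    (hb : ∀ j ∉ A, c k j ≤ b) (hyb : y ≤ b) (hy' : α * y + (1 - α) * b ≤ y')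
    (hd : ∀ j ∉ A, -c k j ≤ d) (hzd : z ≤ d) (hz' : α * z + (1 - α) * d ≤ z')
    (hyz : -z ≤ y) (hne : ∃ i ∉ A, y < c k i) (hne' : ∃ i ∉ A, z < -c k i) :
    (above A (c (k + 1)) y').card + (above A (fun j => -c (k + 1) j) z').card <
      (above A (c k) y).card + (above A (fun j => -c k j) z).card := by
  classical
  obtain ⟨hsub1, hst1⟩ := h.above_succ hA hα hb hyb hy'
  obtain ⟨hsub2, hst2⟩ := h.neg.above_succ hA hα hd hzd hz'
  have hdis : Disjoint (Finset.univ.filter fun j => y < c k j)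
      (Finset.univ.filter fun j => z < -c k j) := by
    rw [Finset.disjoint_filter]
    intro j _ h1 h2
    linarith
  obtain ⟨s, hsA, hs⟩ := hne
  obtain ⟨t, htA, ht⟩ := hne'
  obtain ⟨i, hiA, hi⟩ := hG.exists_cooperative hA hdis ⟨s, by simpa using hs, hsA⟩
    ⟨t, by simpa using ht, htA⟩
  rcases hi with hi | hi
  · obtain ⟨hm, hj⟩ := h.exists_retained_of_mem_reachable hiA hi
    exact add_lt_add_of_lt_of_le (Finset.card_lt_card
      ((Finset.ssubset_iff_of_subset hsub1).2 ⟨i, hm, hst1 i hm hj⟩)) (Finset.card_le_card hsub2)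
  · obtain ⟨hm, hj⟩ := h.neg.exists_retained_of_mem_reachable hiA hi
    exact add_lt_add_of_le_of_lt (Finset.card_le_card hsub1) (Finset.card_lt_card
      ((Finset.ssubset_iff_of_subset hsub2).2 ⟨i, hm, hst2 i hm hj⟩))

theorem gap_closes (h : IsWMSRRun G F A α R w c) (hG : IsRSRobust G (F + 1) (F + 1))
    (hA : A.card ≤ F) (hα : 0 < α) {M m : ℝ}
    (hM : ∀ k, ∃ i ∉ A, M ≤ c k i) (hm : ∀ k, ∃ i ∉ A, c k i ≤ m)
    (hMlim : ∀ δ > 0, ∀ᶠ k in atTop, ∀ i ∉ A, c k i ≤ M + δ)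
    (hmlim : ∀ δ > 0, ∀ᶠ k in atTop, ∀ i ∉ A, m - δ ≤ c k i) : M ≤ m := by
  by_contra! hlt
  obtain ⟨i₀, hi₀, -⟩ := hM 0
  have hα1 : α ≤ 1 := by
    rw [← h.weight_sum 0 i₀ hi₀]
    have := Finset.sum_nonneg fun j hj => hα.le.trans (h.weight_nbr 0 i₀ hi₀ j hj)
    linarith [h.weight_self 0 i₀ hi₀]
  set e : ℝ := (M - m) / 2 with he
  have he0 : 0 < e := by rw [he]; linarith
  set β : ℝ := α / 2 with hβ
  have hβ0 : 0 < β := by positivity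
  have hβ1 : β ≤ 1 := by linarith
  set n : ℕ := 2 * Fintype.card V + 1 with hn
  set δ : ℝ := β ^ (n + 1) * e with hδ
  have hδ0 : 0 < δ := by positivity
  obtain ⟨k₀, hk₀⟩ := eventually_atTop.1 ((hMlim δ hδ0).and (hmlim δ hδ0))
  let f : ℕ → ℕ := fun j => (above A (c (k₀ + j)) (M - β ^ j * e)).card +
    (above A (fun i => -c (k₀ + j) i) (-m - β ^ j * e)).card
  have hstep : ∀ j ≤ n, f (j + 1) < f j := by
    intro j hj
    obtain ⟨hu, hl⟩ := hk₀ (k₀ + j) (Nat.le_add_right _ _)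
    have hpos : 0 < β ^ j * e := by positivity
    have hle : β ^ j * e ≤ e := mul_le_of_le_one_left he0.le (pow_le_one₀ hβ0.le hβ1)
    have hδj : δ ≤ β * (β ^ j * e) := by
      rw [hδ, ← mul_assoc, ← pow_succ']
      exact mul_le_mul_of_nonneg_right (pow_le_pow_of_le_one hβ0.le hβ1 (by omega)) he0.le
    have hδ' : (1 - α) * δ ≤ β * (β ^ j * e) := by nlinarith
    have hα2 : α = 2 * β := by rw [hβ]; ring
    have hs : β ^ (j + 1) * e = β * (β ^ j * e) := by ring
    obtain ⟨s, hsA, hs1⟩ := hM (k₀ + j)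
    obtain ⟨t, htA, ht1⟩ := hm (k₀ + j)
    refine h.step_card hG hA hα (k := k₀ + j) (b := M + δ) (d := -m + δ) hu (by linarith) ?_
      (fun i hi => by linarith [hl i hi]) (by linarith) ?_ (by linarith) ⟨s, hsA, by linarith⟩
      ⟨t, htA, by linarith⟩
    · rw [hs]; linear_combination hδ' + (β ^ j * e) * hα2.ge
    · rw [hs]; linear_combination hδ' + (β ^ j * e) * hα2.ge
  have hdec : ∀ j ≤ n + 1, f j + j ≤ f 0 := by
    intro j
    induction j with
    | zero => simp
    | succ j ih => intro hj; have := ih (by omega); have := hstep j (by omega); omega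
  have h0 : f 0 ≤ 2 * Fintype.card V := by
    have := fun x y => Finset.card_le_univ (above A x y)
    rw [two_mul]
    exact add_le_add (this _ _) (this _ _)
  have := hdec (n + 1) le_rfl
  omega

end IsWMSRRun

/-- On an `(F + 1, F + 1)`-robust network, W-MSR with parameter `F` rejects up to `F`
non-cooperative robots. -/
theorem IsRSRobust.wmsrRejectsGlobal (hG : IsRSRobust G (F + 1) (F + 1))
    (hF : F < Fintype.card V) : WMSRRejectsGlobal G F := by
  classical
  intro A α R w c hA hα h
  have hne : (Finset.univ \ A).Nonempty := by
    obtain ⟨i, hi, hiA⟩ := Finset.exists_mem_notMem_of_card_lt_card (s := A) (t := Finset.univ)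
      (hA.trans_lt hF)
    exact ⟨i, by simpa using hiA⟩
  have hmemA : ∀ {i}, i ∈ Finset.univ \ A ↔ i ∉ A := by simp
  let u : ℕ → ℝ := fun k => (Finset.univ \ A).sup' hne (c k)
  let l : ℕ → ℝ := fun k => (Finset.univ \ A).inf' hne (c k)
  have hu : ∀ k, ∀ i ∉ A, c k i ≤ u k := fun k i hi => Finset.le_sup' (c k) (hmemA.2 hi)
  have hl : ∀ k, ∀ i ∉ A, l k ≤ c k i := fun k i hi => Finset.inf'_le (c k) (hmemA.2 hi)
  have hu' : ∀ k, ∃ i ∉ A, c k i = u k := fun k => by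
    obtain ⟨i, hi, e⟩ := Finset.exists_mem_eq_sup' hne (c k)
    exact ⟨i, hmemA.1 hi, e.symm⟩
  have hl' : ∀ k, ∃ i ∉ A, c k i = l k := fun k => by
    obtain ⟨i, hi, e⟩ := Finset.exists_mem_eq_inf' hne (c k)
    exact ⟨i, hmemA.1 hi, e.symm⟩
  have hanti : Antitone u := antitone_nat_of_succ_le fun k =>
    Finset.sup'_le _ _ fun i hi => h.update_le_bound hA hα (hu k) (hmemA.1 hi)
  have hmono : Monotone l := monotone_nat_of_le_succ fun k =>
    Finset.le_inf' _ _ fun i hi => by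
      have := h.neg.update_le_bound hA hα (k := k) (b := -l k)
        (fun j hj => neg_le_neg (hl k j hj)) (hmemA.1 hi)
      linarith
  have hlu : ∀ j k, l j ≤ u k := fun j k => by
    obtain ⟨i, hi⟩ := hne
    have hi := hmemA.1 hi
    exact (hmono (le_max_left j k)).trans (((hl _ i hi).trans (hu _ i hi)).trans
      (hanti (le_max_right j k)))
  have hbu : BddBelow (Set.range u) := ⟨l 0, by rintro _ ⟨k, rfl⟩; exact hlu 0 k⟩
  have hbl : BddAbove (Set.range l) := ⟨u 0, by rintro _ ⟨k, rfl⟩; exact hlu k 0⟩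
  have htu := tendsto_atTop_ciInf hanti hbu
  have htl := tendsto_atTop_ciSup hmono hbl
  set M := ⨅ k, u k
  set m := ⨆ k, l k
  have hMm : M ≤ m := by
    refine h.gap_closes hG hA hα (fun k => ?_) (fun k => ?_) (fun δ hδ => ?_) (fun δ hδ => ?_)
    · obtain ⟨i, hi, e⟩ := hu' k
      exact ⟨i, hi, e ▸ ciInf_le hbu k⟩
    · obtain ⟨i, hi, e⟩ := hl' k
      exact ⟨i, hi, e ▸ le_ciSup hbl k⟩
    · filter_upwards [htu.eventually_le_const (lt_add_of_pos_right M hδ)] with k hk i hi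
      exact (hu k i hi).trans hk
    · filter_upwards [htl.eventually_const_le (sub_lt_self m hδ)] with k hk i hi
      exact hk.trans (hl k i hi)
  have hmM : m ≤ M := ciSup_le fun j => le_ciInf fun k => hlu j k
  rw [← le_antisymm hMm hmM] at htl
  refine ⟨M, fun i hi => tendsto_of_tendsto_of_tendsto_of_le_of_le htl htu
    (fun k => hl k i hi) (fun k => hu k i hi), ?_, ?_⟩
  · obtain ⟨i, hi, e⟩ := hl' 0
    exact ⟨i, hi, e ▸ (le_ciSup hbl 0).trans hmM⟩
  · obtain ⟨i, hi, e⟩ := hu' 0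
    exact ⟨i, hi, e ▸ ciInf_le hbu 0⟩

end WMSRConvergence

theorem theorem1 {V : Type*} [Fintype V] (hN : 2 < Fintype.card V)
    (p : V → Plane) (hp : Function.Injective p) (hcol : ¬ Collinear ℝ (Set.range p))
    (G : SimpleGraph V) (hG : IsDelaunayGraph p G) :
    IsRSRobust G 2 2 ∧ WMSRRejectsGlobal G 1 :=
  have h := hG.isRSRobust hp hcol
  ⟨h, h.wmsrRejectsGlobal (by omega)⟩
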